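/- For $n\ge 0$ let $\Pi(n)$ be the set of set partitions of $[n]=\{1,\dots,n\}$, and let $B_n=|\Pi(n)|$ be the $n$-th Bell number, with the convention $B_m=0$ for $m<0$. An arc of $\lambda\in\Pi(n)$ is a pair $(e,f)$ of elements of a common block of $\lambda$ such that $f$ is the smallest element of that block greater than $e$. Let $i(\lambda)$ (the intertwining exponent of $\lambda$, equal to the number $cr_2(\lambda)$ of $2$-crossings) be the number of pairs of arcs $(e_1,f_1)$, $(e_2,f_2)$ of $\lambda$ with $e_1<e_2<f_1<f_2$, and put $M(i^k;n):=\sum_{\lambda\in\Pi(n)} i(\lambda)^k$ (with $0^0=1$). For each integer $k\ge 0$ there exist polynomials $Q_{k,2k},Q_{k,2k-1},\dots,Q_{k,-k}$ with rational coefficients, where $Q_{k,2k-j}$ has degree at most $j$ for $0\le j\le 3k$, such that for all integers $n\ge 0$ $$M(i^k;n)=\sum_{j=0}^{3k} Q_{k,2k-j}(n)\,B_{n+2k-j}.$$ Moreover, for all $n\ge 0$, $$M(i;n)=\tfrac14\bigl((2n+1)B_n+(2n+9)B_{n+1}-5B_{n+2}\bigr),$$ $$M(i^2;n)=\tfrac1{144}\bigl((36n^2+24n-23)B_n+(72n^2+72n-260)B_{n+1}+(36n^2+156n+489)B_{n+2}-(180n+814)B_{n+3}+225B_{n+4}\bigr).$$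 -/

import Mathlib

namespace SetPartition

/-- The arcs of a set partition `P` of `[n] = {1, …, n}`: the pairs `(i, j)` with `i < j` in a common
block such that no element of that block lies strictly between `i` and `j`. -/
def arcs {n : ℕ} (P : Finpartition (Finset.Icc 1 n)) : Finset (ℕ × ℕ) :=
  (Finset.Icc 1 n ×ˢ Finset.Icc 1 n).filter fun e =>
    ∃ b ∈ P.parts, e.1 ∈ b ∧ e.2 ∈ b ∧ e.1 < e.2 ∧ ∀ m ∈ b, ¬ (e.1 < m ∧ m < e.2)

/-- The intertwining exponent: the number of pairs of arcs `(e₁, f₁)`, `(e₂, f₂)` with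
`e₁ < e₂ < f₁ < f₂`, that is, the number of 2-crossings. -/
def intertwining {n : ℕ} (P : Finpartition (Finset.Icc 1 n)) : ℕ :=
  ((arcs P ×ˢ arcs P).filter fun p =>
    p.1.1 < p.2.1 ∧ p.2.1 < p.1.2 ∧ p.1.2 < p.2.2).card

/-- The aggregate `M(i^k; n)` of the `k`-th power of the intertwining exponent over all set
partitions of `[n]`. -/
def moment (k n : ℕ) : ℚ :=
  ∑ P : Finpartition (Finset.Icc 1 n), (intertwining P : ℚ) ^ k

/-- The Bell number `B_m` for an integer index `m`, with `B_m = 0` for `m < 0`. -/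
def bell (m : ℤ) : ℚ :=
  if 0 ≤ m then (Nat.bell m.toNat : ℚ) else 0

end SetPartition

/-!
Open some blocks of a set partition of `[n]` and let each of them carry an infinite arc, counted in
crossings with the finite arcs. If `n + 1` joins one of `h` open blocks, the new arc crosses the
infinite arcs to its right, so the number of crossings increases by one of `0, 1, …, h - 1`. Summing
powers turns this recursion into a linear differential equation for the exponential generating
functions of the moments, in which Faulhaber's polynomials in `w ∂/∂w` appear. Dividing the `k`-th
moment series by the zeroth one leaves a first order equation along the vector field
`∂/∂x - (1 + w) ∂/∂w`, under which `1 + w` decays like `exp (-x)`. It is solved by combinations of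
`x ^ b * exp (s * x) * (1 + w) ^ l`. At `w = 0` the zeroth series is the generating function of the
Bell numbers, where multiplication by `exp x` and differentiation raise the index and
multiplication by `x` lowers it at the price of a factor `n`.
-/

namespace SetPartition

open Finset
open PowerSeries hiding derivative
open scoped Polynomial

/-! ### Adding a largest element to a set partition -/

section Adjoin

variable {α : Type*} [DecidableEq α] {s t : Finset α} {a e x y : α}

theorem eq_of_forall_part_eq {P Q : Finpartition s} (h : ∀ x ∈ s, P.part x = Q.part x) :
    P = Q := by
  have key : ∀ {P Q : Finpartition s}, (∀ x ∈ s, P.part x = Q.part x) → P.parts ⊆ Q.parts := by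
    intro P Q h p hp
    obtain ⟨x, hx⟩ := P.nonempty_of_mem_parts hp
    rw [← P.part_eq_of_mem hp hx, h x (P.subset hp hx)]
    exact Q.part_mem.2 (P.subset hp hx)
  exact Finpartition.ext ((key h).antisymm (key fun x hx => (h x hx).symm))

/-- The set partition of `t = s ∪ {a}` obtained from a set partition `P` of `s` by adding `a` to the
block of `e`. If `e ∉ s`, then `P.part e = ∅` and `a` becomes a singleton block. -/
def adjoin (P : Finpartition s) (ha : a ∉ s) (ht : insert a s = t) (e : α) : Finpartition t :=
  (P.avoid (P.part e)).extend (b := insert a (P.part e)) (insert_ne_empty _ _)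
    (disjoint_insert_right.2 ⟨fun h => ha (mem_sdiff.1 h).1, sdiff_disjoint⟩)
    (by rw [← ht, sup_eq_union, union_insert, sdiff_union_of_subset (P.part_subset e)])

theorem part_adjoin_self (P : Finpartition s) (ha : a ∉ s) (ht : insert a s = t) (e : α) :
    (adjoin P ha ht e).part a = insert a (P.part e) :=
  Finpartition.part_eq_of_mem _ (mem_insert_self _ _) (mem_insert_self _ _)

theorem part_adjoin_of_mem (P : Finpartition s) (ha : a ∉ s) (ht : insert a s = t)
    (hx : x ∈ P.part e) : (adjoin P ha ht e).part x = insert a (P.part e) :=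
  Finpartition.part_eq_of_mem _ (mem_insert_self _ _) (mem_insert_of_mem hx)

theorem part_adjoin_of_notMem (P : Finpartition s) (ha : a ∉ s) (ht : insert a s = t)
    (hxs : x ∈ s) (hx : x ∉ P.part e) : (adjoin P ha ht e).part x = P.part x := by
  have hxx := P.mem_part_self.2 hxs
  refine Finpartition.part_eq_of_mem _ (mem_insert_of_mem ((Finpartition.mem_avoid _).2 ?_)) hxx
  refine ⟨P.part x, P.part_mem.2 hxs, fun h => hx (h hxx), sdiff_eq_self_of_disjoint ?_⟩
  refine disjoint_left.2 fun y hyx hye => hx ?_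
  have hes : e ∈ s := P.part_nonempty.1 ⟨y, hye⟩
  rwa [P.eq_of_mem_parts (P.part_mem.2 hes) (P.part_mem.2 hxs) hye hyx]

theorem mem_part_adjoin (P : Finpartition s) (ha : a ∉ s) (ht : insert a s = t) (hxa : x ≠ a) :
    y ∈ (adjoin P ha ht e).part x ↔ y ∈ P.part x ∨ y = a ∧ x ∈ P.part e := by
  by_cases hxe : x ∈ P.part e
  · have hes : e ∈ s := P.part_nonempty.1 ⟨x, hxe⟩
    rw [part_adjoin_of_mem P ha ht hxe, P.part_eq_of_mem (P.part_mem.2 hes) hxe, mem_insert]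
    tauto
  · by_cases hxs : x ∈ s
    · rw [part_adjoin_of_notMem P ha ht hxs hxe]
      tauto
    · have hxt : x ∉ t := fun h => hxs ((mem_insert.1 (ht ▸ h)).resolve_left hxa)
      simp only [Finpartition.part_eq_empty _ |>.2 hxt, Finpartition.part_eq_empty _ |>.2 hxs, hxe,
        notMem_empty, and_false, or_self]

/-- The set partition of `s` induced by a set partition of `t = s ∪ {a}`. -/
def remove (Q : Finpartition t) (ha : a ∉ s) (ht : insert a s = t) : Finpartition s :=
  (Q.avoid {a}).copy (by rw [← ht, sdiff_singleton_eq_erase, erase_insert ha])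

theorem part_remove (Q : Finpartition t) (ha : a ∉ s) (ht : insert a s = t) (hx : x ∈ s) :
    (remove Q ha ht).part x = (Q.part x).erase a := by
  have hxt : x ∈ t := ht ▸ mem_insert_of_mem hx
  have hxa : x ≠ a := ne_of_mem_of_not_mem hx ha
  have hxx := Q.mem_part_self.2 hxt
  refine Finpartition.part_eq_of_mem _ ?_ (mem_erase.2 ⟨hxa, hxx⟩)
  exact (Finpartition.mem_avoid _).2 ⟨Q.part x, Q.part_mem.2 hxt,
    fun h => hxa (mem_singleton.1 (h hxx)), sdiff_singleton_eq_erase _ _⟩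

theorem remove_adjoin (P : Finpartition s) (ha : a ∉ s) (ht : insert a s = t) (e : α) :
    remove (adjoin P ha ht e) ha ht = P := by
  refine eq_of_forall_part_eq fun x hx => ?_
  have hap : ∀ y, a ∉ P.part y := fun y h => ha (P.part_subset y h)
  rw [part_remove _ ha ht hx]
  by_cases hxe : x ∈ P.part e
  · have hes : e ∈ s := P.part_nonempty.1 ⟨x, hxe⟩
    rw [part_adjoin_of_mem P ha ht hxe, erase_insert (hap e),
      P.part_eq_of_mem (P.part_mem.2 hes) hxe]
  · rw [part_adjoin_of_notMem P ha ht hx hxe, erase_eq_of_notMem (hap x)]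

theorem adjoin_remove (Q : Finpartition t) (ha : a ∉ s) (ht : insert a s = t)
    (he : (remove Q ha ht).part e = (Q.part a).erase a) :
    adjoin (remove Q ha ht) ha ht e = Q := by
  have hat : a ∈ t := ht ▸ mem_insert_self a s
  have haa := Q.mem_part_self.2 hat
  have hself : insert a ((remove Q ha ht).part e) = Q.part a := by rw [he, insert_erase haa]
  refine eq_of_forall_part_eq fun x hx => ?_
  by_cases hxa : x ∈ Q.part a
  · rw [Q.part_eq_of_mem (Q.part_mem.2 hat) hxa, ← hself]
    by_cases hne : x = a
    · rw [hne, part_adjoin_self]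
    · exact part_adjoin_of_mem _ ha ht (he ▸ mem_erase.2 ⟨hne, hxa⟩)
  · have hne : x ≠ a := fun h => hxa (h ▸ haa)
    have hxs : x ∈ s := (mem_insert.1 (ht ▸ hx)).resolve_left hne
    rw [part_adjoin_of_notMem _ ha ht hxs (he ▸ fun h => hxa (mem_of_mem_erase h)),
      part_remove Q ha ht hxs, erase_eq_of_notMem]
    exact fun h => hxa (Q.part_eq_of_mem (Q.part_mem.2 hx) h ▸ Q.mem_part_self.2 hx)

end Adjoin

section BlockMaxima

variable {α : Type*} [LinearOrder α] {s t : Finset α} {a e x : α}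

/-- The largest elements of the blocks of a set partition. -/
def blockMaxima (P : Finpartition s) : Finset α := s.filter fun e => ∀ m ∈ P.part e, m ≤ e

theorem mem_blockMaxima {P : Finpartition s} :
    e ∈ blockMaxima P ↔ e ∈ s ∧ ∀ m ∈ P.part e, m ≤ e := mem_filter

theorem injOn_part_blockMaxima (P : Finpartition s) (ha : a ∉ s) :
    Set.InjOn P.part (insert a (blockMaxima P)) := by
  have hnone : P.part a = ∅ := P.part_eq_empty.2 ha
  have hsome : ∀ {e}, e ∈ blockMaxima P → e ∈ P.part e :=
    fun he => P.mem_part_self.2 (mem_blockMaxima.1 he).1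
  rintro e (rfl | he) e' (rfl | he') h
  · rfl
  · simpa [← h, hnone] using hsome he'
  · simpa [h, hnone] using hsome he
  · exact le_antisymm ((mem_blockMaxima.1 he').2 e (h ▸ hsome he))
      ((mem_blockMaxima.1 he).2 e' (h ▸ hsome he'))

theorem exists_blockMaxima_part_eq (Q : Finpartition t) (ha : a ∉ s) (ht : insert a s = t) :
    ∃ e ∈ insert a (blockMaxima (remove Q ha ht)),
      (remove Q ha ht).part e = (Q.part a).erase a := by
  rcases ((Q.part a).erase a).eq_empty_or_nonempty with h | h
  · exact ⟨a, mem_insert_self _ _, by rw [h, Finpartition.part_eq_empty]; exact ha⟩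
  · set e := ((Q.part a).erase a).max' h
    obtain ⟨hea, heQ⟩ := mem_erase.1 (max'_mem _ h)
    have hat : a ∈ t := ht ▸ mem_insert_self a s
    have hes : e ∈ s := (mem_insert.1 (ht ▸ Q.part_subset a heQ)).resolve_left hea
    have hpart : (remove Q ha ht).part e = (Q.part a).erase a := by
      rw [part_remove Q ha ht hes, Q.part_eq_of_mem (Q.part_mem.2 hat) heQ]
    exact ⟨e, mem_insert_of_mem (mem_blockMaxima.2 ⟨hes, fun m hm => le_max' _ _ (hpart ▸ hm)⟩),
      hpart⟩

theorem sum_eq_sum_adjoin {M : Type*} [AddCommMonoid M] (ha : a ∉ s) (ht : insert a s = t)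
    (F : Finpartition t → M) :
    ∑ Q, F Q = ∑ P : Finpartition s, ∑ e ∈ insert a (blockMaxima P), F (adjoin P ha ht e) := by
  rw [sum_sigma']
  symm
  refine sum_bij (fun x _ => adjoin x.1 ha ht x.2) (fun _ _ => mem_univ _) ?_ ?_ fun _ _ => rfl
  · rintro ⟨P, e⟩ he ⟨P', e'⟩ he' h
    obtain rfl : P = P' := by simpa only [remove_adjoin] using congrArg (remove · ha ht) h
    have hpart := congrArg (Finpartition.part · a) h
    simp only [part_adjoin_self] at hpart
    have hnot : ∀ x, a ∉ P.part x := fun x hx => ha (P.part_subset x hx)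
    have := injOn_part_blockMaxima P ha (by simpa using he) (by simpa using he')
      (by rw [← erase_insert (hnot e), hpart, erase_insert (hnot e')])
    rw [this]
  · intro Q _
    obtain ⟨e, he, hpart⟩ := exists_blockMaxima_part_eq Q ha ht
    exact ⟨⟨remove Q ha ht, e⟩, mem_sigma.2 ⟨mem_univ _, he⟩, adjoin_remove Q ha ht hpart⟩

theorem blockMaxima_adjoin (P : Finpartition s) (ha : ∀ x ∈ s, x < a) (ht : insert a s = t)
    (he : e ∈ insert a (blockMaxima P)) :
    blockMaxima (adjoin P (fun h => (ha a h).false) ht e) = insert a ((blockMaxima P).erase e) := by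
  have ha' : a ∉ s := fun h => (ha a h).false
  have hle : ∀ m ∈ P.part e, m ≤ e := by
    rcases mem_insert.1 he with rfl | he
    · exact fun m hm => (ha m (P.part_subset _ hm)).le
    · exact (mem_blockMaxima.1 he).2
  ext x
  have hxt : x ∈ t ↔ x = a ∨ x ∈ s := by rw [← ht, mem_insert]
  rw [mem_insert, mem_erase, mem_blockMaxima, mem_blockMaxima, hxt]
  rcases eq_or_ne x a with rfl | hxa
  · rw [part_adjoin_self]
    simp only [true_or, true_and, iff_true]
    exact forall_mem_insert _ _ _ |>.2 ⟨le_rfl, fun m hm => (ha m (P.part_subset e hm)).le⟩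
  · simp only [hxa, false_or, mem_part_adjoin P ha' ht hxa]
    constructor
    · rintro ⟨hxs, hmax⟩
      refine ⟨?_, hxs, fun m hm => hmax m (Or.inl hm)⟩
      rintro rfl
      exact (ha x hxs).not_ge (hmax a (Or.inr ⟨rfl, P.mem_part_self.2 hxs⟩))
    · rintro ⟨hxe, hxs, hmax⟩
      refine ⟨hxs, fun m hm => hm.elim (hmax m) fun ⟨_, hx⟩ => ?_⟩
      have hes : e ∈ s := P.part_nonempty.1 ⟨x, hx⟩
      rw [P.part_eq_of_mem (P.part_mem.2 hes) hx] at hmax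
      exact absurd ((hle x hx).antisymm (hmax e (P.mem_part_self.2 hes))) hxe

end BlockMaxima

section Arcs

variable {n e : ℕ} {P : Finpartition (Icc 1 n)} {b : ℕ × ℕ}

theorem mem_arcs :
    b ∈ arcs P ↔ b.2 ∈ P.part b.1 ∧ b.1 < b.2 ∧ ∀ m ∈ P.part b.1, ¬(b.1 < m ∧ m < b.2) := by
  simp only [arcs, mem_filter, mem_product]
  constructor
  · rintro ⟨-, p, hp, h₁, h₂, hlt, hgap⟩
    obtain rfl := P.part_eq_of_mem hp h₁
    exact ⟨h₂, hlt, hgap⟩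
  · rintro ⟨h₂, hlt, hgap⟩
    have h₁ : b.1 ∈ Icc 1 n := P.part_nonempty.1 ⟨_, h₂⟩
    exact ⟨⟨h₁, P.part_subset _ h₂⟩, _, P.part_mem.2 h₁, P.mem_part_self.2 h₁, h₂, hlt, hgap⟩

theorem snd_le_of_mem_arcs (hb : b ∈ arcs P) : b.2 ≤ n :=
  (mem_Icc.1 (P.part_subset _ (mem_arcs.1 hb).1)).2

theorem le_of_mem_blockMaxima (he : e ∈ blockMaxima P) : e ≤ n :=
  (mem_Icc.1 (mem_blockMaxima.1 he).1).2

/-- The set partition of `[n + 1]` obtained from a set partition `P` of `[n]` by adding `n + 1` to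
the block of `e`, or as a singleton block if `e = n + 1`. -/
def adjoinLast (P : Finpartition (Icc 1 n)) (e : ℕ) : Finpartition (Icc 1 (n + 1)) :=
  adjoin P (a := n + 1) (by simp) (insert_Icc_right_eq_Icc_add_one (by simp)) e

theorem mem_arcs_adjoinLast (P : Finpartition (Icc 1 n)) :
    b ∈ arcs (adjoinLast P e) ↔
      b ∈ arcs P ∨ b.2 = n + 1 ∧ b.1 ∈ P.part e ∧ ∀ m ∈ P.part e, m ≤ b.1 := by
  have hle : ∀ {x y}, y ∈ P.part x → y ≤ n := fun h => (mem_Icc.1 (P.part_subset _ h)).2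
  rw [mem_arcs, mem_arcs]
  rcases eq_or_ne b.1 (n + 1) with hb | hb
  · have hnone : ∀ x, b.1 ∉ P.part x := fun x h => by have := hle h; omega
    refine iff_of_false (fun ⟨h₂, hlt, _⟩ => ?_) ?_
    · have := hlt.trans_le (mem_Icc.1 (Finpartition.part_subset _ _ h₂)).2
      omega
    · rintro (⟨h₂, hlt, -⟩ | ⟨-, h₁, -⟩)
      · have := hle h₂
        omega
      · exact hnone _ h₁
  · simp only [adjoinLast, mem_part_adjoin P _ _ hb]
    constructor
    · rintro ⟨h₂ | ⟨h₂, h₁⟩, hlt, hgap⟩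
      · exact Or.inl ⟨h₂, hlt, fun m hm => hgap m (Or.inl hm)⟩
      · have hes : e ∈ Icc 1 n := P.part_nonempty.1 ⟨_, h₁⟩
        rw [P.part_eq_of_mem (P.part_mem.2 hes) h₁] at hgap
        refine Or.inr ⟨h₂, h₁, fun m hm => ?_⟩
        have := hgap m (Or.inl hm)
        have := hle hm
        omega
    · rintro (⟨h₂, hlt, hgap⟩ | ⟨h₂, h₁, hmax⟩)
      · have := hle h₂
        exact ⟨Or.inl h₂, hlt, fun m hm => hm.elim (hgap m) (by omega)⟩
      · have hes : e ∈ Icc 1 n := P.part_nonempty.1 ⟨_, h₁⟩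
        have := hle h₁
        rw [P.part_eq_of_mem (P.part_mem.2 hes) h₁]
        refine ⟨Or.inr ⟨h₂, h₁⟩, by omega, fun m hm => ?_⟩
        rcases hm with hm | ⟨rfl, -⟩
        · have := hmax m hm
          omega
        · omega

theorem arcs_adjoinLast_last (P : Finpartition (Icc 1 n)) :
    arcs (adjoinLast P (n + 1)) = arcs P := by
  ext b
  rw [mem_arcs_adjoinLast, P.part_eq_empty.2 (by simp)]
  simp

theorem arcs_adjoinLast (he : e ∈ blockMaxima P) :
    arcs (adjoinLast P e) = insert (e, n + 1) (arcs P) := by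
  obtain ⟨hes, hmax⟩ := mem_blockMaxima.1 he
  ext b
  rw [mem_arcs_adjoinLast, mem_insert, or_comm, Prod.ext_iff]
  refine or_congr_left ⟨fun ⟨h₂, h₁, hle⟩ => ⟨?_, h₂⟩, fun ⟨h₁, h₂⟩ => ?_⟩
  · exact (hmax _ h₁).antisymm (hle e (P.mem_part_self.2 hes))
  · exact ⟨h₂, h₁ ▸ P.mem_part_self.2 hes, h₁ ▸ hmax⟩

theorem blockMaxima_adjoinLast (he : e ∈ insert (n + 1) (blockMaxima P)) :
    blockMaxima (adjoinLast P e) = insert (n + 1) ((blockMaxima P).erase e) :=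
  blockMaxima_adjoin P (fun _ hx => Nat.lt_succ_of_le (mem_Icc.1 hx).2) _ he

theorem sum_arcs_blockMaxima_succ {M : Type*} [AddCommMonoid M]
    (F : Finset (ℕ × ℕ) → Finset ℕ → M) :
    ∑ Q : Finpartition (Icc 1 (n + 1)), F (arcs Q) (blockMaxima Q) =
      ∑ P : Finpartition (Icc 1 n), (F (arcs P) (insert (n + 1) (blockMaxima P)) +
        ∑ e ∈ blockMaxima P,
          F (insert (e, n + 1) (arcs P)) (insert (n + 1) ((blockMaxima P).erase e))) := by
  rw [sum_eq_sum_adjoin (a := n + 1) (by simp) (insert_Icc_right_eq_Icc_add_one (by simp))]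
  refine sum_congr rfl fun P _ => ?_
  have hlast : n + 1 ∉ blockMaxima P := fun h => by simpa using le_of_mem_blockMaxima h
  rw [sum_insert hlast]
  change F (arcs (adjoinLast P (n + 1))) (blockMaxima (adjoinLast P (n + 1))) +
    ∑ e ∈ blockMaxima P, F (arcs (adjoinLast P e)) (blockMaxima (adjoinLast P e)) = _
  rw [arcs_adjoinLast_last, blockMaxima_adjoinLast (mem_insert_self _ _), erase_eq_of_notMem hlast]
  refine congrArg _ (sum_congr rfl fun e he => ?_)
  rw [arcs_adjoinLast he, blockMaxima_adjoinLast (mem_insert_of_mem he)]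

end Arcs

/-! ### Power sums as differential operators -/

section PowerSum

variable {M N : Type*} [AddCommGroup M] [Module ℚ M] [AddCommGroup N] [Module ℚ N]

/-- The operator `∂ ∘ r_j(w ∂)` for `∂ = D` and multiplication by `w = W`, where `r_j` is the
Faulhaber polynomial with `h * r_j(h) = 0 ^ j + 1 ^ j + ⋯ + (h - 1) ^ j`. It replaces `w ^ h` by
`(0 ^ j + ⋯ + (h - 1) ^ j) w ^ (h - 1)`. -/
noncomputable def powerSumOp (D W : Module.End ℚ M) (j : ℕ) : Module.End ℚ M :=
  ∑ i ∈ range (j + 1), (bernoulli i * (j + 1).choose i / (j + 1) : ℚ) • (D * (W * D) ^ (j - i))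

theorem powerSumOp_zero (D W : Module.End ℚ M) : powerSumOp D W 0 = D := by
  simp [powerSumOp]

theorem mul_mul_eq_of_mul_eq_add_one {D W : Module.End ℚ M} (hDW : D * W = W * D + 1) :
    D * (W * D) = W * D ^ 2 + D := by
  rw [← mul_assoc, hDW, add_mul, one_mul, mul_assoc, pow_two]

theorem powerSumOp_one {D W : Module.End ℚ M} (hDW : D * W = W * D + 1) :
    powerSumOp D W 1 = (1 / 2 : ℚ) • (W * D ^ 2) := by
  rw [powerSumOp, sum_range_succ, sum_range_one]
  norm_num [bernoulli_one, mul_mul_eq_of_mul_eq_add_one hDW]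

theorem powerSumOp_two {D W : Module.End ℚ M} (hDW : D * W = W * D + 1) :
    powerSumOp D W 2 = (1 / 2 : ℚ) • (W * D ^ 2) + (1 / 3 : ℚ) • (W ^ 2 * D ^ 3) := by
  have hWD : W * D * (W * D ^ 2) = W ^ 2 * D ^ 3 + W * D ^ 2 := by
    rw [mul_assoc, ← mul_assoc D, hDW]
    noncomm_ring
  have hD₂ : D * (W * D) ^ 2 = W ^ 2 * D ^ 3 + (3 : ℚ) • (W * D ^ 2) + D := by
    have hDWD : D * (W * D) ^ 2 = W * D * (D * (W * D)) + D * (W * D) :=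
      calc D * (W * D) ^ 2 = D * W * (D * (W * D)) := by noncomm_ring
        _ = W * D * (D * (W * D)) + D * (W * D) := by rw [hDW, add_one_mul]
    rw [hDWD, mul_mul_eq_of_mul_eq_add_one hDW, mul_add, hWD, mul_assoc, ← pow_two]
    module
  have hbernoulli : powerSumOp D W 2 = (1 / 3 : ℚ) • (D * (W * D) ^ 2) -
      (1 / 2 : ℚ) • (D * (W * D)) + (1 / 6 : ℚ) • D := by
    rw [powerSumOp, sum_range_succ, sum_range_succ, sum_range_one]
    norm_num [bernoulli_one, bernoulli_two, sub_eq_add_neg]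
  rw [hbernoulli, hD₂, mul_mul_eq_of_mul_eq_add_one hDW]
  module

theorem map_powerSumOp {D W : Module.End ℚ M} {D' W' : Module.End ℚ N} (φ : M →ₗ[ℚ] N)
    (hD : ∀ x, φ (D x) = D' (φ x)) (hW : ∀ x, φ (W x) = W' (φ x)) (j : ℕ) (x : M) :
    φ (powerSumOp D W j x) = powerSumOp D' W' j (φ x) := by
  have hpow : ∀ i y, φ (((W * D) ^ i) y) = ((W' * D') ^ i) (φ y) := by
    intro i
    induction i with
    | zero => exact fun _ => rfl
    | succ i ih =>
      intro y
      rw [pow_succ, pow_succ, Module.End.mul_apply, Module.End.mul_apply, ih, Module.End.mul_apply,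
        Module.End.mul_apply, hW, hD]
  simp only [powerSumOp, LinearMap.sum_apply, LinearMap.smul_apply, Module.End.mul_apply, map_sum,
    map_smul, hD, hpow]

theorem powerSumOp_X_pow (j h : ℕ) :
    powerSumOp (Polynomial.derivative.restrictScalars ℚ)
        (LinearMap.mulLeft ℚ (Polynomial.X : ℚ[X])) j (Polynomial.X ^ h) =
      (∑ c ∈ range h, (c : ℚ) ^ j) • (Polynomial.X : ℚ[X]) ^ (h - 1) := by
  set D : Module.End ℚ ℚ[X] := Polynomial.derivative.restrictScalars ℚ
  set W : Module.End ℚ ℚ[X] := LinearMap.mulLeft ℚ Polynomial.X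
  have hD : D (Polynomial.X ^ h) = (h : ℚ) • (Polynomial.X : ℚ[X]) ^ (h - 1) := by
    simp [D, Polynomial.derivative_X_pow, Polynomial.smul_eq_C_mul]
  have hWD : (W * D) (Polynomial.X ^ h) = (h : ℚ) • (Polynomial.X : ℚ[X]) ^ h := by
    rcases h with - | h
    · simp [D]
    · rw [Module.End.mul_apply, hD, map_smul, LinearMap.mulLeft_apply, Nat.add_sub_cancel,
        pow_succ']
  have hpow : ∀ i, ((W * D) ^ i) (Polynomial.X ^ h) = (h : ℚ) ^ i • (Polynomial.X : ℚ[X]) ^ h := by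
    intro i
    induction i with
    | zero => simp
    | succ i ih => rw [pow_succ, Module.End.mul_apply, hWD, map_smul, ih, smul_smul, pow_succ']
  simp only [powerSumOp, LinearMap.sum_apply, LinearMap.smul_apply, Module.End.mul_apply, hpow,
    map_smul, hD, smul_smul, ← sum_smul, sum_range_pow]
  refine congrArg (· • _) (sum_congr rfl fun i hi => ?_)
  rw [Nat.sub_add_comm (Nat.lt_succ_iff.1 (mem_range.1 hi)), pow_succ]
  ring

end PowerSum

section OpenCrossings

/-- The number of crossings among the arcs in `A` and infinite arcs starting at the points of `O`,
where infinite arcs do not cross each other. -/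
def openCrossings (A : Finset (ℕ × ℕ)) (O : Finset ℕ) : ℕ :=
  #{p ∈ A ×ˢ A | p.1.1 < p.2.1 ∧ p.2.1 < p.1.2 ∧ p.1.2 < p.2.2} +
    #{p ∈ A ×ˢ O | p.1.1 < p.2 ∧ p.2 < p.1.2}

variable {A : Finset (ℕ × ℕ)} {O S : Finset ℕ} {e f : ℕ}

theorem openCrossings_insert_right (hA : ∀ a ∈ A, a.2 ≤ f) :
    openCrossings A (insert f O) = openCrossings A O := by
  unfold openCrossings
  congr 2
  ext ⟨a, o⟩
  simp only [mem_filter, mem_product, mem_insert]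
  refine ⟨?_, fun ⟨⟨ha, ho⟩, h⟩ => ⟨⟨ha, Or.inr ho⟩, h⟩⟩
  rintro ⟨⟨ha, rfl | ho⟩, h⟩
  · exact absurd h.2 (hA a ha).not_gt
  · exact ⟨⟨ha, ho⟩, h⟩

theorem openCrossings_insert_left (hA : ∀ a ∈ A, a.2 < f) (hO : ∀ o ∈ O, o < f) (he : e ∉ O) :
    openCrossings (insert (e, f) A) O =
      openCrossings A (insert e O) + #{o ∈ insert e O | e < o} := by
  have hef : (e, f) ∉ A := fun h => (hA _ h).false
  have hnone : ∑ a ∈ A, (if e < a.1 ∧ a.1 < f ∧ f < a.2 then 1 else 0) = 0 :=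
    sum_eq_zero fun a ha => if_neg fun h => (hA a ha).not_gt h.2.2
  have hcross : ∑ a ∈ A, (if a.1 < e ∧ e < a.2 ∧ a.2 < f then 1 else 0) =
      ∑ a ∈ A, if a.1 < e ∧ e < a.2 then 1 else 0 :=
    sum_congr rfl fun a ha => if_congr (by simp only [hA a ha, and_true]) rfl rfl
  have hright : ∑ o ∈ O, (if e < o ∧ o < f then 1 else 0) = ∑ o ∈ O, if e < o then 1 else 0 :=
    sum_congr rfl fun o ho => if_congr (by simp only [hO o ho, and_true]) rfl rfl
  simp only [openCrossings, card_filter, sum_product, sum_insert hef, sum_insert he,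
    sum_add_distrib, lt_irrefl, and_false, if_false, hnone, hcross, hright]
  ring

theorem sum_card_filter_gt {α M : Type*} [LinearOrder α] [AddCommMonoid M] (S : Finset α)
    (g : ℕ → M) : ∑ e ∈ S, g #{x ∈ S | e < x} = ∑ c ∈ range #S, g c := by
  induction S using Finset.induction_on_max generalizing g with
  | empty => simp
  | insert a s hs ih =>
    have ha : a ∉ s := fun h => lt_irrefl _ (hs a h)
    rw [sum_insert ha, card_insert_of_notMem ha, sum_range_succ', add_comm]
    congr 1
    · rw [← ih]
      refine sum_congr rfl fun e he => ?_
      rw [filter_insert, if_pos (hs e he), card_insert_of_notMem (by simp [ha])]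
    · congr 1
      rw [card_eq_zero, filter_eq_empty_iff]
      intro x hx
      rcases mem_insert.1 hx with rfl | hx
      · exact lt_irrefl _
      · exact not_lt.2 (hs x hx).le

theorem sum_powerset_erase {α M : Type*} [DecidableEq α] [AddCommMonoid M] (S : Finset α)
    (φ : α → Finset α → M) :
    ∑ e ∈ S, ∑ O ∈ (S.erase e).powerset, φ e (insert e O) =
      ∑ T ∈ S.powerset, ∑ e ∈ T, φ e T := by
  rw [sum_comm' (t' := S) (s' := fun e => S.powerset.filter (e ∈ ·)) fun T e => by
    simp only [mem_powerset, mem_filter]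
    exact ⟨fun h => ⟨h, h.1 h.2⟩, And.left⟩]
  refine sum_congr rfl fun e he => sum_nbij' (insert e) (erase · e) ?_ ?_ ?_ ?_ fun _ _ => rfl
  · intro O hO
    simp only [mem_filter, mem_powerset] at hO ⊢
    exact ⟨insert_subset he (hO.trans (erase_subset _ _)), mem_insert_self _ _⟩
  · intro T hT
    exact mem_powerset.2 (erase_subset_erase _ (mem_powerset.1 (mem_filter.1 hT).1))
  · exact fun O hO => erase_insert fun h => notMem_erase e S (mem_powerset.1 hO h)
  · exact fun T hT => insert_erase (mem_filter.1 hT).2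

/-- The generating polynomial of the `k`-th powers of the numbers of crossings of the arcs in `A`
and infinite arcs starting at points of `S`, in which `X` marks the number of infinite arcs. -/
noncomputable def openSum (k : ℕ) (A : Finset (ℕ × ℕ)) (S : Finset ℕ) : ℚ[X] :=
  ∑ O ∈ S.powerset, (openCrossings A O : ℚ) ^ k • Polynomial.X ^ #O

theorem openSum_insert_last (hA : ∀ a ∈ A, a.2 ≤ f) (hf : f ∉ S) (k : ℕ) :
    openSum k A (insert f S) = (1 + Polynomial.X) * openSum k A S := by
  rw [openSum, sum_powerset_insert hf, add_mul, one_mul, openSum, mul_sum]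
  refine congrArg _ (sum_congr rfl fun O hO => ?_)
  rw [openCrossings_insert_right hA, card_insert_of_notMem fun h => hf (mem_powerset.1 hO h),
    mul_smul_comm, pow_succ']

/-- The operator `powerSumOp` for differentiation and multiplication by `X` on polynomials. -/
noncomputable abbrev polyPowerSumOp (j : ℕ) : Module.End ℚ ℚ[X] :=
  powerSumOp (Polynomial.derivative.restrictScalars ℚ) (LinearMap.mulLeft ℚ Polynomial.X) j

theorem sum_add_pow_eq_powerSumOp (k c h : ℕ) :
    (∑ i ∈ range h, ((c + i : ℕ) : ℚ) ^ k) • (Polynomial.X : ℚ[X]) ^ (h - 1) =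
      ∑ p ∈ antidiagonal k, (k.choose p.1 : ℚ) •
        polyPowerSumOp p.1 ((c : ℚ) ^ p.2 • Polynomial.X ^ h) := by
  simp only [map_smul, polyPowerSumOp, powerSumOp_X_pow, smul_smul, ← sum_smul]
  refine congrArg (· • _) ?_
  simp only [mul_sum]
  rw [sum_comm]
  refine sum_congr rfl fun i _ => ?_
  rw [Nat.cast_add, add_comm, (Commute.all (i : ℚ) c).add_pow']
  refine sum_congr rfl fun p _ => ?_
  rw [nsmul_eq_mul]
  ring

theorem sum_openSum_insert_arc (hA : ∀ a ∈ A, a.2 < f) (hS : ∀ o ∈ S, o < f) (k : ℕ) :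
    ∑ e ∈ S, openSum k (insert (e, f) A) (S.erase e) =
      ∑ p ∈ antidiagonal k, (k.choose p.1 : ℚ) • polyPowerSumOp p.1 (openSum p.2 A S) := by
  calc ∑ e ∈ S, openSum k (insert (e, f) A) (S.erase e)
    _ = ∑ T ∈ S.powerset, ∑ e ∈ T, ((openCrossings A T + #{o ∈ T | e < o} : ℕ) : ℚ) ^ k •
          (Polynomial.X : ℚ[X]) ^ (#T - 1) := by
      rw [← sum_powerset_erase]
      refine sum_congr rfl fun e _ => sum_congr rfl fun O hO => ?_
      have hOS := mem_powerset.1 hO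
      have heO : e ∉ O := fun h => notMem_erase _ _ (hOS h)
      rw [openCrossings_insert_left hA (fun o ho => hS o (mem_of_mem_erase (hOS ho))) heO,
        card_insert_of_notMem heO, Nat.add_sub_cancel]
    _ = ∑ T ∈ S.powerset, ∑ p ∈ antidiagonal k, (k.choose p.1 : ℚ) •
          polyPowerSumOp p.1 ((openCrossings A T : ℚ) ^ p.2 • Polynomial.X ^ #T) := by
      refine sum_congr rfl fun T _ => ?_
      rw [sum_card_filter_gt T fun c => ((openCrossings A T + c : ℕ) : ℚ) ^ k •
        (Polynomial.X : ℚ[X]) ^ (#T - 1), ← sum_smul, sum_add_pow_eq_powerSumOp]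
    _ = _ := by
      rw [sum_comm]
      simp only [openSum, map_sum, smul_sum]

end OpenCrossings

section OpenMoment

/-- The sum of the `k`-th powers of the numbers of crossings of the set partitions of `[n]` with
some open blocks, in which `X` marks the open blocks. An open block is one to which elements larger
than `n` will be added; its largest element starts an infinite arc. -/
noncomputable def openMoment (n k : ℕ) : ℚ[X] :=
  ∑ P : Finpartition (Icc 1 n), openSum k (arcs P) (blockMaxima P)

theorem openMoment_zero (k : ℕ) : openMoment 0 k = if k = 0 then 1 else 0 := by
  have harcs : ∀ P : Finpartition (Icc 1 0), arcs P = ∅ := fun P => by simp [arcs]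
  have hmax : ∀ P : Finpartition (Icc 1 0), blockMaxima P = ∅ := fun P => by simp [blockMaxima]
  have hcross : openCrossings ∅ ∅ = 0 := by simp [openCrossings]
  have : Unique (Finpartition (Icc 1 0)) :=
    inferInstanceAs (Unique (Finpartition (⊥ : Finset ℕ)))
  simp [openMoment, openSum, harcs, hmax, hcross, zero_pow_eq]

theorem openMoment_succ (n k : ℕ) :
    openMoment (n + 1) k = (1 + Polynomial.X) * (openMoment n k +
      ∑ p ∈ antidiagonal k, (k.choose p.1 : ℚ) • polyPowerSumOp p.1 (openMoment n p.2)) := by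
  have hlast : ∀ P : Finpartition (Icc 1 n), n + 1 ∉ blockMaxima P := fun P h => by
    simpa using le_of_mem_blockMaxima h
  have hsnd : ∀ P : Finpartition (Icc 1 n), ∀ a ∈ arcs P, a.2 < n + 1 := fun P a ha =>
    Nat.lt_succ_of_le (snd_le_of_mem_arcs ha)
  have hsum : ∀ P : Finpartition (Icc 1 n),
      openSum k (arcs P) (insert (n + 1) (blockMaxima P)) + ∑ e ∈ blockMaxima P,
        openSum k (insert (e, n + 1) (arcs P)) (insert (n + 1) ((blockMaxima P).erase e)) =
      (1 + Polynomial.X) * (openSum k (arcs P) (blockMaxima P) + ∑ p ∈ antidiagonal k,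
        (k.choose p.1 : ℚ) • polyPowerSumOp p.1 (openSum p.2 (arcs P) (blockMaxima P))) := by
    intro P
    rw [← sum_openSum_insert_arc (hsnd P) fun e he => Nat.lt_succ_of_le (le_of_mem_blockMaxima he),
      mul_add, mul_sum, openSum_insert_last (fun a ha => (hsnd P a ha).le) (hlast P)]
    refine congrArg _ (sum_congr rfl fun e _ => openSum_insert_last ?_ ?_ k)
    · exact forall_mem_insert _ _ _ |>.2 ⟨le_rfl, fun a ha => (hsnd P a ha).le⟩
    · exact fun h => hlast P (mem_of_mem_erase h)
  rw [openMoment, sum_arcs_blockMaxima_succ (openSum k), sum_congr rfl fun P _ => hsum P, ← mul_sum,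
    sum_add_distrib, sum_comm]
  simp only [openMoment, map_sum, smul_sum]

theorem eval_zero_openMoment (n k : ℕ) : (openMoment n k).eval 0 = moment k n := by
  simp only [openMoment, openSum, moment, Polynomial.eval_finsetSum]
  refine sum_congr rfl fun P _ => ?_
  rw [sum_eq_single_of_mem ∅ (empty_mem_powerset _)]
  · simp [openCrossings, intertwining]
  · intro O _ hO
    simp [card_ne_zero.2 (nonempty_iff_ne_empty.2 hO)]

end OpenMoment

/-! ### Exponential generating functions -/

section ExponentialGeneratingFunctions

variable {R : Type*} [CommRing R] [Algebra ℚ R]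

/-- The coefficient of `X ^ n / n!`, so that a power series is read as an exponential generating
function. -/
noncomputable def egfCoeff (n : ℕ) : R⟦X⟧ →ₗ[ℚ] R :=
  (n.factorial : ℚ) • (coeff n).restrictScalars ℚ

theorem egfCoeff_apply (n : ℕ) (f : R⟦X⟧) : egfCoeff n f = (n.factorial : ℚ) • coeff n f := rfl

theorem egfCoeff_C_mul (n : ℕ) (r : R) (f : R⟦X⟧) : egfCoeff n (C r * f) = r * egfCoeff n f := by
  rw [egfCoeff_apply, egfCoeff_apply, coeff_C_mul, mul_smul_comm]

theorem egfCoeff_mul (n : ℕ) (f g : R⟦X⟧) :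
    egfCoeff n (f * g) =
      ∑ p ∈ antidiagonal n, (n.choose p.1 : ℚ) • (egfCoeff p.1 f * egfCoeff p.2 g) := by
  simp only [egfCoeff_apply, coeff_mul, smul_sum]
  refine sum_congr rfl fun p hp => ?_
  obtain rfl := mem_antidiagonal.1 hp
  rw [smul_mul_smul_comm, smul_smul, ← Nat.add_choose_mul_factorial_mul_factorial, Nat.cast_mul,
    Nat.cast_mul, mul_assoc, Nat.choose_symm_add]

theorem egfCoeff_X_pow_mul (n b : ℕ) (f : R⟦X⟧) :
    egfCoeff n (X ^ b * f) = (n.descFactorial b : ℚ) • egfCoeff (n - b) f := by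
  rw [egfCoeff_apply, egfCoeff_apply, coeff_X_pow_mul']
  split_ifs with hbn
  · rw [smul_smul, ← Nat.cast_mul, mul_comm, Nat.factorial_mul_descFactorial hbn]
  · rw [Nat.descFactorial_of_lt (not_le.1 hbn), Nat.cast_zero, zero_smul, smul_zero]

theorem egfCoeff_derivative (n : ℕ) (f : R⟦X⟧) : egfCoeff n (d⁄dX R f) = egfCoeff (n + 1) f := by
  rw [egfCoeff_apply, egfCoeff_apply, coeff_derivative, ← Nat.cast_succ, mul_comm, ← nsmul_eq_mul,
    ← Nat.cast_smul_eq_nsmul ℚ, smul_smul, Nat.factorial_succ, mul_comm, ← Nat.cast_mul]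

theorem ext_egfCoeff {f g : R⟦X⟧} (h : ∀ n, egfCoeff n f = egfCoeff n g) : f = g := by
  ext n
  exact smul_right_injective R (Nat.cast_ne_zero.2 n.factorial_ne_zero : (n.factorial : ℚ) ≠ 0)
    (h n)

end ExponentialGeneratingFunctions

section CoefficientwiseDerivation

variable {S R : Type*} [CommRing S] [CommRing R] [Algebra S R]

/-- The derivation of `R⟦X⟧` which applies a derivation of `R` to every coefficient. -/
noncomputable def coeffDerivation (δ : Derivation S R R) : Derivation S R⟦X⟧ R⟦X⟧ :=
  Derivation.mk'
    { toFun := fun f => PowerSeries.mk fun n => δ (coeff n f)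
      map_add' := fun f g => by ext n; simp
      map_smul' := fun r f => by ext n; simp }
    fun f g => by
      ext n
      simp only [LinearMap.coe_mk, AddHom.coe_mk, coeff_mk, coeff_mul, map_sum, map_add,
        Derivation.leibniz, smul_eq_mul, sum_add_distrib]
      congr 1
      rw [← Finset.sum_equiv (Equiv.prodComm ℕ ℕ) (s := antidiagonal n)
        (by simp [add_comm]) fun _ _ => rfl]
      simp

theorem coeff_coeffDerivation (δ : Derivation S R R) (n : ℕ) (f : R⟦X⟧) :
    coeff n (coeffDerivation δ f) = δ (coeff n f) :=
  coeff_mk n fun m => δ (coeff m f)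

theorem egfCoeff_coeffDerivation {R : Type*} [CommRing R] [Algebra ℚ R] (δ : Derivation ℚ R R)
    (n : ℕ) (f : R⟦X⟧) : egfCoeff n (coeffDerivation δ f) = δ (egfCoeff n f) := by
  rw [egfCoeff_apply, egfCoeff_apply, coeff_coeffDerivation, map_rat_smul]

theorem egfCoeff_powerSumOp {R : Type*} [CommRing R] [Algebra ℚ R] (δ : Derivation ℚ R R) (r : R)
    (n j : ℕ) (f : R⟦X⟧) :
    egfCoeff n (powerSumOp (coeffDerivation δ).toLinearMap (LinearMap.mulLeft ℚ (C r)) j f) =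
      powerSumOp δ.toLinearMap (LinearMap.mulLeft ℚ r) j (egfCoeff n f) :=
  map_powerSumOp (egfCoeff n) (egfCoeff_coeffDerivation δ n) (egfCoeff_C_mul n r) j f

theorem coeffDerivation_C (δ : Derivation S R R) (r : R) :
    coeffDerivation δ (C r) = C (δ r) := by
  ext n
  rw [coeff_coeffDerivation, coeff_C, coeff_C]
  split_ifs <;> simp

theorem coeffDerivation_X (δ : Derivation S R R) : coeffDerivation δ X = 0 := by
  ext n
  rw [coeff_coeffDerivation, coeff_X]
  split_ifs <;> simp

/-- The derivation `∂/∂X - v δ` of `R⟦X⟧`, where `δ` acts on the coefficients. -/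
noncomputable def transport (δ : Derivation S R R) (v : R) : Derivation S R⟦X⟧ R⟦X⟧ :=
  (d⁄dX R).restrictScalars S - C v • coeffDerivation δ

theorem transport_apply (δ : Derivation S R R) (v : R) (f : R⟦X⟧) :
    transport δ v f = d⁄dX R f - C v * coeffDerivation δ f := rfl

theorem transport_coeffDerivation (δ : Derivation S R R) (v : R) (f : R⟦X⟧) :
    transport δ v (coeffDerivation δ f) =
      coeffDerivation δ (transport δ v f) + C (δ v) * coeffDerivation δ f := by
  have hcomm : d⁄dX R (coeffDerivation δ f) = coeffDerivation δ (d⁄dX R f) := by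
    ext n
    simp [coeff_derivative, coeff_coeffDerivation, Derivation.leibniz, mul_comm]
  rw [transport_apply, transport_apply, hcomm, map_sub, Derivation.leibniz, coeffDerivation_C]
  simp only [smul_eq_mul]
  ring

theorem eq_zero_of_transport_eq_mul [IsAddTorsionFree R] {δ : Derivation S R R} {v : R}
    {f a : R⟦X⟧} (hf : transport δ v f = a * f) (h₀ : constantCoeff f = 0) : f = 0 := by
  have hder : d⁄dX R f = C v * coeffDerivation δ f + a * f := by
    rw [← hf, transport_apply, add_sub_cancel]
  have hcoeff : ∀ n, ∀ m ≤ n, coeff m f = 0 := by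
    intro n
    induction n with
    | zero => simpa using h₀
    | succ n ih =>
      have hsucc := congrArg (coeff n) hder
      rw [coeff_derivative, map_add, coeff_C_mul, coeff_coeffDerivation, ih n le_rfl, map_zero,
        mul_zero, zero_add, coeff_mul, sum_eq_zero, ← Nat.cast_succ, mul_comm, ← nsmul_eq_mul,
        nsmul_eq_zero_iff_right n.succ_ne_zero] at hsucc
      · intro m hm
        exact (Nat.of_le_succ hm).elim (ih m) fun h => h ▸ hsucc
      · intro p hp
        rw [ih p.2 (mem_antidiagonal.1 hp ▸ Nat.le_add_left _ _), mul_zero]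
  exact ext fun n => by simpa using hcoeff n n le_rfl

end CoefficientwiseDerivation

section MomentSeries

/-- The variable marking open blocks. The elements of `ℚ[X]⟦X⟧` are read as exponential generating
functions in `X` (marking the size of the ground set) with coefficients in `ℚ[w]`. -/
noncomputable def w : ℚ[X]⟦X⟧ := C Polynomial.X

/-- The derivation `∂/∂w`. -/
noncomputable def derivW : Derivation ℚ ℚ[X]⟦X⟧ ℚ[X]⟦X⟧ := coeffDerivation Polynomial.derivative'

/-- The derivation `∂/∂X - (1 + w) ∂/∂w`, along which the moment series are transported. -/
noncomputable def derivT : Derivation ℚ ℚ[X]⟦X⟧ ℚ[X]⟦X⟧ :=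
  transport Polynomial.derivative' (1 + Polynomial.X)

theorem derivT_apply (f : ℚ[X]⟦X⟧) : derivT f = d⁄dX ℚ[X] f - (1 + w) * derivW f := by
  rw [derivT, transport_apply, map_add, map_one]
  rfl

theorem eq_of_derivT_eq {f g : ℚ[X]⟦X⟧} (hT : derivT f = derivT g)
    (h₀ : constantCoeff f = constantCoeff g) : f = g := by
  rw [← sub_eq_zero]
  refine eq_zero_of_transport_eq_mul (a := 0) (?_ : derivT _ = _) ?_
  · rw [map_sub, hT, sub_self, zero_mul]
  · rw [map_sub, h₀, sub_self]

theorem derivT_derivW (f : ℚ[X]⟦X⟧) : derivT (derivW f) = derivW (derivT f) + derivW f := by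
  rw [derivT, derivW, transport_coeffDerivation]
  simp

theorem derivW_w : derivW w = 1 := by
  rw [derivW, w, coeffDerivation_C]
  simp

theorem derivW_exp : derivW (exp ℚ[X]) = 0 := by
  ext1 n
  rw [derivW, coeff_coeffDerivation, coeff_exp]
  simp

theorem derivW_X : derivW X = 0 := coeffDerivation_X _

theorem derivT_X : derivT X = 1 := by
  rw [derivT_apply, derivW_X, derivative_X, mul_zero, sub_zero]

theorem derivT_exp : derivT (exp ℚ[X]) = exp ℚ[X] := by
  rw [derivT_apply, derivW_exp, derivative_exp, mul_zero, sub_zero]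

theorem derivT_w : derivT w = -(1 + w) := by
  rw [derivT_apply, derivW_w, w, derivative_C, mul_one, zero_sub]

/-- The exponential generating function of the polynomials `openMoment n k`. -/
noncomputable def momentSeries (k : ℕ) : ℚ[X]⟦X⟧ :=
  PowerSeries.mk fun n => (n.factorial : ℚ)⁻¹ • openMoment n k

theorem egfCoeff_momentSeries (n k : ℕ) : egfCoeff n (momentSeries k) = openMoment n k := by
  rw [egfCoeff_apply, momentSeries, coeff_mk,
    smul_inv_smul₀ (Nat.cast_ne_zero.2 n.factorial_ne_zero)]

theorem constantCoeff_momentSeries (k : ℕ) :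
    constantCoeff (momentSeries k) = if k = 0 then 1 else 0 := by
  simp [momentSeries, ← coeff_zero_eq_constantCoeff_apply, openMoment_zero]

/-- The operator `powerSumOp` for `∂/∂w` and multiplication by `w`. -/
noncomputable abbrev derivWPowerSumOp (j : ℕ) : Module.End ℚ ℚ[X]⟦X⟧ :=
  powerSumOp derivW.toLinearMap (LinearMap.mulLeft ℚ w) j

theorem derivWPowerSumOp_zero (f : ℚ[X]⟦X⟧) : derivWPowerSumOp 0 f = derivW f := by
  rw [derivWPowerSumOp, powerSumOp_zero, Derivation.coeFn_coe]

theorem egfCoeff_derivWPowerSumOp (n j : ℕ) (f : ℚ[X]⟦X⟧) :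
    egfCoeff n (derivWPowerSumOp j f) = polyPowerSumOp j (egfCoeff n f) :=
  egfCoeff_powerSumOp Polynomial.derivative' Polynomial.X n j f

theorem derivative_momentSeries (k : ℕ) :
    d⁄dX ℚ[X] (momentSeries k) = (1 + w) * (momentSeries k +
      ∑ p ∈ antidiagonal k, (k.choose p.1 : ℚ) • derivWPowerSumOp p.1 (momentSeries p.2)) := by
  refine ext_egfCoeff fun n => ?_
  have hv : (1 + w : ℚ[X]⟦X⟧) = C (1 + Polynomial.X) := by rw [map_add, map_one, w]
  rw [egfCoeff_derivative, egfCoeff_momentSeries, openMoment_succ, hv, egfCoeff_C_mul, map_add,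
    map_sum]
  simp only [map_smul, egfCoeff_derivWPowerSumOp, egfCoeff_momentSeries]

theorem derivT_momentSeries_zero : derivT (momentSeries 0) = (1 + w) * momentSeries 0 := by
  simp only [derivT_apply, derivative_momentSeries, Nat.antidiagonal_zero, sum_singleton,
    Nat.choose_self, Nat.cast_one, one_smul, derivWPowerSumOp_zero]
  ring

theorem derivT_momentSeries_succ (k : ℕ) :
    derivT (momentSeries (k + 1)) = (1 + w) * (momentSeries (k + 1) +
      ∑ p ∈ antidiagonal k,
        ((k + 1).choose (p.1 + 1) : ℚ) • derivWPowerSumOp (p.1 + 1) (momentSeries p.2)) := by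
  simp only [derivT_apply, derivative_momentSeries, Nat.sum_antidiagonal_succ,
    Nat.choose_zero_right, Nat.cast_one, one_smul, derivWPowerSumOp_zero]
  ring

theorem derivW_momentSeries_zero :
    derivW (momentSeries 0) = (exp ℚ[X] - 1) * momentSeries 0 := by
  rw [← sub_eq_zero]
  refine eq_zero_of_transport_eq_mul (a := 1 + (1 + w)) (?_ : derivT _ = _) ?_
  · rw [map_sub, derivT_derivW, derivT_momentSeries_zero, Derivation.leibniz, Derivation.leibniz,
      derivT_momentSeries_zero, map_sub, map_add, derivT_exp, derivW_w]
    simp only [smul_eq_mul, Derivation.map_one_eq_zero]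
    ring
  · rw [← coeff_zero_eq_constantCoeff_apply, map_sub, derivW, coeff_coeffDerivation]
    simp [constantCoeff_momentSeries]

end MomentSeries

section MomentFactor

/-- The conjugate of `∂/∂w` by multiplication by `momentSeries 0`. -/
noncomputable def twistedDerivW : Module.End ℚ ℚ[X]⟦X⟧ :=
  derivW.toLinearMap + LinearMap.mulLeft ℚ (exp ℚ[X] - 1)

theorem twistedDerivW_apply (g : ℚ[X]⟦X⟧) :
    twistedDerivW g = derivW g + (exp ℚ[X] - 1) * g := rfl

/-- The operator `powerSumOp` for `twistedDerivW` and multiplication by `w`. -/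
noncomputable abbrev twistedPowerSumOp (j : ℕ) : Module.End ℚ ℚ[X]⟦X⟧ :=
  powerSumOp twistedDerivW (LinearMap.mulLeft ℚ w) j

theorem derivWPowerSumOp_mul_momentSeries_zero (j : ℕ) (g : ℚ[X]⟦X⟧) :
    derivWPowerSumOp j (g * momentSeries 0) = twistedPowerSumOp j g * momentSeries 0 := by
  refine (map_powerSumOp (LinearMap.mulRight ℚ (momentSeries 0)) ?_ ?_ j g).symm
  · intro g
    simp only [LinearMap.mulRight_apply, twistedDerivW_apply, Derivation.coeFn_coe,
      Derivation.leibniz, derivW_momentSeries_zero, smul_eq_mul]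
    ring
  · exact fun g => mul_assoc w g _

/-- The quotient of `momentSeries k` by `momentSeries 0`. -/
noncomputable def momentFactor (k : ℕ) : ℚ[X]⟦X⟧ :=
  momentSeries k * invOfUnit (momentSeries 0) 1

theorem momentSeries_zero_mul_invOfUnit :
    momentSeries 0 * invOfUnit (momentSeries 0) 1 = 1 :=
  mul_invOfUnit _ _ (by simp [constantCoeff_momentSeries])

theorem momentFactor_mul_momentSeries_zero (k : ℕ) :
    momentFactor k * momentSeries 0 = momentSeries k := by
  rw [momentFactor, mul_assoc, mul_comm _ (momentSeries 0), momentSeries_zero_mul_invOfUnit,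
    mul_one]

theorem momentFactor_zero : momentFactor 0 = 1 := momentSeries_zero_mul_invOfUnit

theorem constantCoeff_momentFactor_succ (k : ℕ) : constantCoeff (momentFactor (k + 1)) = 0 := by
  simp [momentFactor, constantCoeff_momentSeries]

theorem derivT_momentFactor_succ (k : ℕ) :
    derivT (momentFactor (k + 1)) = (1 + w) * ∑ p ∈ antidiagonal k,
      ((k + 1).choose (p.1 + 1) : ℚ) • twistedPowerSumOp (p.1 + 1) (momentFactor p.2) := by
  have hne : momentSeries 0 ≠ 0 := fun h => by
    simpa [h] using constantCoeff_momentSeries 0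
  refine mul_right_cancel₀ hne ?_
  have hT := derivT_momentSeries_succ k
  simp only [← momentFactor_mul_momentSeries_zero (k + 1), Derivation.leibniz, smul_eq_mul,
    derivT_momentSeries_zero] at hT
  have hsum : (∑ p ∈ antidiagonal k, ((k + 1).choose (p.1 + 1) : ℚ) •
      twistedPowerSumOp (p.1 + 1) (momentFactor p.2)) * momentSeries 0 =
      ∑ p ∈ antidiagonal k,
        ((k + 1).choose (p.1 + 1) : ℚ) • derivWPowerSumOp (p.1 + 1) (momentSeries p.2) := by
    simp only [sum_mul, smul_mul_assoc, ← derivWPowerSumOp_mul_momentSeries_zero,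
      momentFactor_mul_momentSeries_zero]
  rw [mul_assoc, hsum]
  linear_combination hT

end MomentFactor

section ExponentialMonomials

/-- The basic solutions of the transport equations: `derivT` multiplies `exp ^ s * (1 + w) ^ l` by
`s - l`, and it differentiates powers of `X`. -/
noncomputable def expMonomial (b s l : ℕ) : ℚ[X]⟦X⟧ := X ^ b * exp ℚ[X] ^ s * (1 + w) ^ l

theorem expMonomial_mul (b s l b' s' l' : ℕ) :
    expMonomial b s l * expMonomial b' s' l' = expMonomial (b + b') (s + s') (l + l') := by
  simp only [expMonomial, pow_add]
  ring

theorem constantCoeff_expMonomial_succ (b s l : ℕ) :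
    constantCoeff (expMonomial (b + 1) s l) = 0 := by
  simp [expMonomial]

theorem constantCoeff_expMonomial_zero (s l : ℕ) :
    constantCoeff (expMonomial 0 s l) = (1 + Polynomial.X) ^ l := by
  simp [expMonomial, w]

theorem derivW_expMonomial (b s l : ℕ) :
    derivW (expMonomial b s l) = (l : ℚ) • expMonomial b s (l - 1) := by
  simp only [expMonomial, Derivation.leibniz, Derivation.leibniz_pow, derivW_X, derivW_exp, map_add,
    Derivation.map_one_eq_zero, derivW_w, smul_eq_mul, Nat.cast_smul_eq_nsmul, nsmul_eq_mul]
  ring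

theorem derivT_expMonomial (b s l : ℕ) :
    derivT (expMonomial b s l) =
      (b : ℚ) • expMonomial (b - 1) s l + ((s : ℚ) - l) • expMonomial b s l := by
  have hexp : (s : ℚ[X]⟦X⟧) * (exp ℚ[X] ^ (s - 1) * exp ℚ[X]) = s * exp ℚ[X] ^ s := by
    rcases s with - | s <;> simp [pow_succ]
  have hw : (l : ℚ[X]⟦X⟧) * ((1 + w) ^ (l - 1) * (1 + w)) = l * (1 + w) ^ l := by
    rcases l with - | l <;> simp [pow_succ]
  simp only [expMonomial, Derivation.leibniz, Derivation.leibniz_pow, derivT_X, derivT_exp, map_add,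
    Derivation.map_one_eq_zero, derivT_w, smul_eq_mul, Nat.cast_smul_eq_nsmul, nsmul_eq_mul,
    sub_smul]
  linear_combination X ^ b * (1 + w) ^ l * hexp - X ^ b * exp ℚ[X] ^ s * hw

/-- The span of the monomials in which the degrees in `X`, `exp` and `1 + w` are at most `a`, `S`
and `L`. -/
noncomputable def expSpan (a S L : ℕ) : Submodule ℚ ℚ[X]⟦X⟧ :=
  Submodule.span ℚ {f | ∃ b ≤ a, ∃ s ≤ S, ∃ l ≤ L, f = expMonomial b s l}

variable {a S L a' S' L' b s l : ℕ} {f g : ℚ[X]⟦X⟧}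

theorem expMonomial_mem_expSpan (hb : b ≤ a) (hs : s ≤ S) (hl : l ≤ L) :
    expMonomial b s l ∈ expSpan a S L :=
  Submodule.subset_span ⟨b, hb, s, hs, l, hl, rfl⟩

theorem expSpan_mono (ha : a ≤ a') (hS : S ≤ S') (hL : L ≤ L') :
    expSpan a S L ≤ expSpan a' S' L' := by
  refine Submodule.span_mono ?_
  rintro f ⟨b, hb, s, hs, l, hl, rfl⟩
  exact ⟨b, hb.trans ha, s, hs.trans hS, l, hl.trans hL, rfl⟩

theorem mul_mem_expSpan (hf : f ∈ expSpan a S L) (hg : g ∈ expSpan a' S' L') :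
    f * g ∈ expSpan (a + a') (S + S') (L + L') := by
  have hfg := Submodule.mul_mem_mul hf hg
  rw [expSpan, expSpan, Submodule.span_mul_span] at hfg
  refine Submodule.span_mono ?_ hfg
  rintro _ ⟨_, ⟨b, hb, s, hs, l, hl, rfl⟩, _, ⟨b', hb', s', hs', l', hl', rfl⟩, rfl⟩
  exact ⟨b + b', add_le_add hb hb', s + s', add_le_add hs hs', l + l', add_le_add hl hl',
    expMonomial_mul b s l b' s' l'⟩

theorem one_mem_expSpan : 1 ∈ expSpan a S L := by
  have h := expMonomial_mem_expSpan (Nat.zero_le a) (Nat.zero_le S) (Nat.zero_le L)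
  simpa only [expMonomial, pow_zero, mul_one] using h

theorem exp_mem_expSpan : exp ℚ[X] ∈ expSpan 0 1 0 := by
  have h := expMonomial_mem_expSpan (le_refl 0) (le_refl 1) (le_refl 0)
  simpa only [expMonomial, pow_zero, pow_one, one_mul, mul_one] using h

theorem one_add_w_mem_expSpan : 1 + w ∈ expSpan 0 0 1 := by
  have h := expMonomial_mem_expSpan (le_refl 0) (le_refl 0) (le_refl 1)
  simpa only [expMonomial, pow_zero, pow_one, one_mul] using h

theorem w_mem_expSpan : w ∈ expSpan 0 0 1 := by
  simpa using sub_mem one_add_w_mem_expSpan one_mem_expSpan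

theorem derivW_mem_expSpan (hf : f ∈ expSpan a S L) : derivW f ∈ expSpan a S L := by
  suffices expSpan a S L ≤ (expSpan a S L).comap derivW.toLinearMap from this hf
  refine Submodule.span_le.2 ?_
  rintro _ ⟨b, hb, s, hs, l, hl, rfl⟩
  change derivW _ ∈ expSpan a S L
  rw [derivW_expMonomial]
  exact Submodule.smul_mem _ _ (expMonomial_mem_expSpan hb hs ((Nat.sub_le l 1).trans hl))

theorem twistedDerivW_mem_expSpan (hf : f ∈ expSpan a S L) :
    twistedDerivW f ∈ expSpan a (S + 1) L := by
  refine add_mem (expSpan_mono le_rfl S.le_succ le_rfl (derivW_mem_expSpan hf)) ?_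
  have h := mul_mem_expSpan (sub_mem exp_mem_expSpan one_mem_expSpan) hf
  rwa [zero_add, zero_add, add_comm] at h

theorem twistedPowerSumOp_mem_expSpan (hf : f ∈ expSpan a S L) (j : ℕ) :
    twistedPowerSumOp j f ∈ expSpan a (S + j + 1) (L + j) := by
  have hpow : ∀ i, ((LinearMap.mulLeft ℚ w * twistedDerivW) ^ i) f ∈ expSpan a (S + i) (L + i) := by
    intro i
    induction i with
    | zero => exact hf
    | succ i ih =>
      have h := mul_mem_expSpan w_mem_expSpan (twistedDerivW_mem_expSpan ih)
      rw [zero_add, zero_add, add_comm 1] at h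
      rwa [pow_succ', Module.End.mul_apply]
  rw [twistedPowerSumOp, powerSumOp, LinearMap.sum_apply]
  refine sum_mem fun i _ => Submodule.smul_mem _ _ (twistedDerivW_mem_expSpan ?_)
  exact expSpan_mono le_rfl (by lia) (by lia) (hpow (j - i))

theorem exists_derivT_eq_expMonomial (hb : b ≤ a) (hs : s ≤ L) (hl : l ≤ L) :
    ∃ g ∈ expSpan (a + 1) L L, constantCoeff g = 0 ∧ derivT g = expMonomial b s l := by
  obtain rfl | hsl := eq_or_ne s l
  · refine ⟨((b : ℚ) + 1)⁻¹ • expMonomial (b + 1) s s, Submodule.smul_mem _ _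
      (expMonomial_mem_expSpan (by lia) hs hl), ?_, ?_⟩
    · rw [map_rat_smul, constantCoeff_expMonomial_succ, smul_zero]
    · rw [Derivation.map_smul, derivT_expMonomial, sub_self, zero_smul, add_zero, Nat.cast_succ,
        Nat.add_sub_cancel, inv_smul_smul₀ (by positivity)]
  have hne : (s : ℚ) - l ≠ 0 := sub_ne_zero.2 (Nat.cast_injective.ne hsl)
  induction b with
  | zero =>
    refine ⟨((s : ℚ) - l)⁻¹ • (expMonomial 0 s l - expMonomial 0 l l), Submodule.smul_mem _ _
      (sub_mem (expMonomial_mem_expSpan (by lia) hs hl) (expMonomial_mem_expSpan (by lia) hl hl)),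
      ?_, ?_⟩
    · rw [map_rat_smul, map_sub, constantCoeff_expMonomial_zero, constantCoeff_expMonomial_zero,
        sub_self, smul_zero]
    · simp [derivT_expMonomial, inv_smul_smul₀ hne]
  | succ b ih =>
    obtain ⟨g, hg, hg₀, hgT⟩ := ih (by lia)
    refine ⟨((s : ℚ) - l)⁻¹ • (expMonomial (b + 1) s l - ((b + 1 : ℕ) : ℚ) • g),
      Submodule.smul_mem _ _ (sub_mem (expMonomial_mem_expSpan (by lia) hs hl)
        (Submodule.smul_mem _ _ hg)), ?_, ?_⟩
    · rw [map_rat_smul, map_sub, map_rat_smul, hg₀, constantCoeff_expMonomial_succ, smul_zero,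
        sub_zero, smul_zero]
    · rw [Derivation.map_smul, map_sub, Derivation.map_smul, hgT, derivT_expMonomial,
        Nat.add_sub_cancel, add_sub_cancel_left, inv_smul_smul₀ hne]

theorem exists_derivT_eq (hf : f ∈ expSpan a L L) :
    ∃ g ∈ expSpan (a + 1) L L, constantCoeff g = 0 ∧ derivT g = f := by
  induction hf using Submodule.span_induction with
  | mem f hf =>
    obtain ⟨b, hb, s, hs, l, hl, rfl⟩ := hf
    exact exists_derivT_eq_expMonomial hb hs hl
  | zero => exact ⟨0, zero_mem _, map_zero _, map_zero _⟩
  | add f f' _ _ ih ih' =>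
    obtain ⟨g, hg, hg₀, rfl⟩ := ih
    obtain ⟨g', hg', hg₀', rfl⟩ := ih'
    exact ⟨g + g', add_mem hg hg', by rw [map_add, hg₀, hg₀', add_zero], map_add _ _ _⟩
  | smul r f _ ih =>
    obtain ⟨g, hg, hg₀, rfl⟩ := ih
    exact ⟨r • g, Submodule.smul_mem _ r hg, by rw [map_rat_smul, hg₀, smul_zero],
      Derivation.map_smul _ _ _⟩

theorem momentFactor_mem_expSpan (k : ℕ) : momentFactor k ∈ expSpan k (2 * k) (2 * k) := by
  induction k using Nat.strong_induction_on with
  | _ k ih =>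
    obtain - | k := k
    · exact momentFactor_zero ▸ one_mem_expSpan
    have hmem : (1 + w) * ∑ p ∈ antidiagonal k, ((k + 1).choose (p.1 + 1) : ℚ) •
        twistedPowerSumOp (p.1 + 1) (momentFactor p.2) ∈
          expSpan k (2 * (k + 1)) (2 * (k + 1)) := by
      rw [mul_sum]
      refine sum_mem fun p hp => ?_
      have hpk := mem_antidiagonal.1 hp
      rw [mul_smul_comm]
      exact Submodule.smul_mem _ _ (expSpan_mono (by lia) (by lia) (by lia) (mul_mem_expSpan
        one_add_w_mem_expSpan (twistedPowerSumOp_mem_expSpan (ih p.2 (by lia)) (p.1 + 1))))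
    obtain ⟨g, hg, hg₀, hgT⟩ := exists_derivT_eq hmem
    rwa [eq_of_derivT_eq ((derivT_momentFactor_succ k).trans hgT.symm)
      ((constantCoeff_momentFactor_succ k).trans hg₀.symm)]

end ExponentialMonomials

/-! ### Reading off Bell numbers -/

section BellSeries

/-- The substitution `w = 0`, which forgets the set partitions with open blocks. -/
noncomputable def closeBlocks : ℚ[X]⟦X⟧ →+* ℚ⟦X⟧ := PowerSeries.map (Polynomial.evalRingHom 0)

theorem egfCoeff_closeBlocks (n : ℕ) (f : ℚ[X]⟦X⟧) :
    egfCoeff n (closeBlocks f) = (egfCoeff n f).eval 0 := by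
  simp [closeBlocks, egfCoeff_apply]

theorem closeBlocks_exp : closeBlocks (exp ℚ[X]) = exp ℚ := map_exp _

theorem closeBlocks_w : closeBlocks w = 0 := by
  simp [closeBlocks, w]

theorem closeBlocks_X : closeBlocks X = X := map_X _

/-- The exponential generating function of the Bell numbers. -/
noncomputable def bellSeries : ℚ⟦X⟧ := closeBlocks (momentSeries 0)

theorem moment_eq_egfCoeff (k n : ℕ) :
    moment k n = egfCoeff n (closeBlocks (momentFactor k) * bellSeries) := by
  rw [bellSeries, ← map_mul, momentFactor_mul_momentSeries_zero, egfCoeff_closeBlocks,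
    egfCoeff_momentSeries, eval_zero_openMoment]

theorem derivative_bellSeries : d⁄dX ℚ bellSeries = exp ℚ * bellSeries := by
  have hder : d⁄dX ℚ[X] (momentSeries 0) = (1 + w) * (exp ℚ[X] * momentSeries 0) := by
    have h := derivT_momentSeries_zero
    rw [derivT_apply, derivW_momentSeries_zero] at h
    linear_combination h
  refine ext_egfCoeff fun n => ?_
  rw [egfCoeff_derivative, bellSeries, egfCoeff_closeBlocks, ← egfCoeff_derivative, hder,
    ← egfCoeff_closeBlocks]
  simp only [map_mul, map_add, map_one, closeBlocks_w, closeBlocks_exp, add_zero, one_mul]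

theorem egfCoeff_bellSeries (n : ℕ) : egfCoeff n bellSeries = Nat.bell n := by
  induction n using Nat.strong_induction_on with
  | _ n ih =>
    obtain - | n := n
    · rw [bellSeries, egfCoeff_closeBlocks, egfCoeff_momentSeries, openMoment_zero]
      simp
    rw [← egfCoeff_derivative, derivative_bellSeries, egfCoeff_mul, Nat.bell_succ', Nat.cast_sum]
    refine sum_congr rfl fun p hp => ?_
    have hexp : egfCoeff p.1 (exp ℚ) = 1 := by
      rw [egfCoeff_apply, coeff_exp, smul_eq_mul, eq_ratCast, Rat.cast_id, mul_one_div_cancel]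
      exact Nat.cast_ne_zero.2 p.1.factorial_ne_zero
    rw [hexp, one_mul, ih p.2 (by have := mem_antidiagonal.1 hp; lia), Nat.cast_mul, smul_eq_mul]

theorem exp_pow_succ_mul_bellSeries (s : ℕ) :
    exp ℚ ^ (s + 1) * bellSeries =
      d⁄dX ℚ (exp ℚ ^ s * bellSeries) - (s : ℚ) • (exp ℚ ^ s * bellSeries) := by
  have hexp : (s : ℚ⟦X⟧) * (exp ℚ ^ (s - 1) * exp ℚ) = s * exp ℚ ^ s := by
    rcases s with - | s <;> simp [pow_succ]
  simp only [Derivation.leibniz, Derivation.leibniz_pow, derivative_bellSeries, derivative_exp,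
    smul_eq_mul, Nat.cast_smul_eq_nsmul, nsmul_eq_mul]
  linear_combination -bellSeries * hexp

end BellSeries

section BellCombinations

/-- The sequences `n ↦ ∑ m, Q m n * B (n + m)` with polynomials `Q m`, in which `m` lies between
`-k` and `2 k` and the degree of `Q (2 k - j)` is at most `j`. -/
noncomputable def bellCombinations (k : ℕ) : Submodule ℚ (ℕ → ℚ) where
  carrier := {u | ∃ Q : ℤ → ℚ[X],
    (∀ j : ℕ, j ≤ 3 * k → (Q (2 * (k : ℤ) - (j : ℤ))).natDegree ≤ j) ∧
    ∀ n : ℕ, u n = ∑ m ∈ Icc (-(k : ℤ)) (2 * (k : ℤ)), (Q m).eval (n : ℚ) * bell ((n : ℤ) + m)}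
  zero_mem' := ⟨fun _ => 0, by simp, by simp⟩
  add_mem' := by
    rintro u v ⟨Q, hQ, hu⟩ ⟨Q', hQ', hv⟩
    refine ⟨fun m => Q m + Q' m,
      fun j hj => (Polynomial.natDegree_add_le _ _).trans (max_le (hQ j hj) (hQ' j hj)),
      fun n => ?_⟩
    simp only [Pi.add_apply, hu, hv, Polynomial.eval_add, add_mul, sum_add_distrib]
  smul_mem' := by
    rintro r u ⟨Q, hQ, hu⟩
    refine ⟨fun m => r • Q m, fun j hj => (Polynomial.natDegree_smul_le _ _).trans (hQ j hj),
      fun n => ?_⟩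
    simp only [Pi.smul_apply, hu, Polynomial.eval_smul, smul_eq_mul, mul_sum, mul_assoc]

theorem bell_natCast (n : ℕ) : bell n = Nat.bell n := by
  simp [bell]

variable {k b i : ℕ}

theorem descFactorial_mul_bell_mem_bellCombinations (hb : b ≤ k) (hi : i ≤ 2 * k) :
    (fun n => (n.descFactorial b : ℚ) * Nat.bell (n - b + i)) ∈ bellCombinations k := by
  refine ⟨fun m => if m = (i : ℤ) - b then descPochhammer ℚ b else 0, fun j _ => ?_, fun n => ?_⟩
  · dsimp only
    split_ifs
    · rw [descPochhammer_natDegree]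
      lia
    · simp
  · rw [sum_eq_single_of_mem ((i : ℤ) - b) (by rw [mem_Icc]; lia) fun m _ hm => by simp [hm]]
    dsimp only
    rw [if_pos rfl, descPochhammer_eval_eq_descFactorial]
    rcases le_or_gt b n with hbn | hbn
    · rw [← bell_natCast]
      congr 2
      lia
    · rw [Nat.descFactorial_of_lt hbn, Nat.cast_zero, zero_mul, zero_mul]

theorem descFactorial_mul_egfCoeff_mem_bellCombinations (hb : b ≤ k) {s : ℕ}
    (hs : s + i ≤ 2 * k) :
    (fun n => (n.descFactorial b : ℚ) * egfCoeff (n - b + i) (exp ℚ ^ s * bellSeries)) ∈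
      bellCombinations k := by
  induction s generalizing i with
  | zero =>
    simpa only [pow_zero, one_mul, egfCoeff_bellSeries] using
      descFactorial_mul_bell_mem_bellCombinations hb (by lia)
  | succ s ih =>
    convert sub_mem (ih (i := i + 1) (by lia))
      (Submodule.smul_mem _ (s : ℚ) (ih (i := i) (by lia))) using 1
    funext n
    simp only [exp_pow_succ_mul_bellSeries, map_sub, map_smul, egfCoeff_derivative, Pi.sub_apply,
      Pi.smul_apply, smul_eq_mul, add_assoc]
    ring

theorem moment_mem_bellCombinations (k : ℕ) : moment k ∈ bellCombinations k := by
  suffices ∀ f ∈ expSpan k (2 * k) (2 * k),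
      (fun n => egfCoeff n (closeBlocks f * bellSeries)) ∈ bellCombinations k by
    simpa only [← moment_eq_egfCoeff] using this _ (momentFactor_mem_expSpan k)
  intro f hf
  induction hf using Submodule.span_induction with
  | mem f hf =>
    obtain ⟨b, hb, s, hs, l, -, rfl⟩ := hf
    have hmono : closeBlocks (expMonomial b s l) * bellSeries =
        X ^ b * (exp ℚ ^ s * bellSeries) := by
      simp only [expMonomial, map_mul, map_pow, map_add, map_one, closeBlocks_X, closeBlocks_exp,
        closeBlocks_w, add_zero, one_pow, mul_one, mul_assoc]
    simpa only [hmono, egfCoeff_X_pow_mul, smul_eq_mul, add_zero] using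
      descFactorial_mul_egfCoeff_mem_bellCombinations (i := 0) hb hs
  | zero => simpa only [map_zero, zero_mul, Pi.zero_def] using zero_mem (bellCombinations k)
  | add f g _ _ hf hg => simpa only [map_add, add_mul, Pi.add_def] using add_mem hf hg
  | smul r f _ hf =>
    simpa only [map_rat_smul, smul_mul_assoc, Pi.smul_def] using Submodule.smul_mem _ r hf

end BellCombinations

/-! ### The first two moments -/

section ExplicitFactors

theorem twistedDerivW_mul_mulLeft_w :
    twistedDerivW * LinearMap.mulLeft ℚ w = LinearMap.mulLeft ℚ w * twistedDerivW + 1 := by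
  ext1 g
  simp only [Module.End.mul_apply, LinearMap.mulLeft_apply, LinearMap.add_apply,
    Module.End.one_apply, twistedDerivW_apply, Derivation.leibniz, derivW_w, smul_eq_mul]
  ring

theorem twistedPowerSumOp_one_apply (g : ℚ[X]⟦X⟧) :
    twistedPowerSumOp 1 g = (1 / 2 : ℚ) • (w * twistedDerivW (twistedDerivW g)) := by
  rw [twistedPowerSumOp, powerSumOp_one twistedDerivW_mul_mulLeft_w]
  rfl

theorem twistedPowerSumOp_two_apply (g : ℚ[X]⟦X⟧) :
    twistedPowerSumOp 2 g = (1 / 2 : ℚ) • (w * twistedDerivW (twistedDerivW g)) +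
      (1 / 3 : ℚ) • (w * (w * twistedDerivW (twistedDerivW (twistedDerivW g)))) := by
  rw [twistedPowerSumOp, powerSumOp_two twistedDerivW_mul_mulLeft_w]
  rfl

theorem twistedDerivW_exp_sub_one_pow (n : ℕ) :
    twistedDerivW ((exp ℚ[X] - 1) ^ n) = (exp ℚ[X] - 1) ^ (n + 1) := by
  rw [twistedDerivW_apply, Derivation.leibniz_pow, map_sub, derivW_exp,
    Derivation.map_one_eq_zero, sub_zero, smul_zero, smul_zero, zero_add, pow_succ']

theorem twistedDerivW_one : twistedDerivW 1 = exp ℚ[X] - 1 := by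
  simpa using twistedDerivW_exp_sub_one_pow 0

theorem twistedDerivW_exp_sub_one : twistedDerivW (exp ℚ[X] - 1) = (exp ℚ[X] - 1) ^ 2 := by
  simpa using twistedDerivW_exp_sub_one_pow 1

theorem derivT_momentFactor_one :
    derivT (momentFactor 1) = (1 / 2 : ℚ) • ((1 + w) * (w * (exp ℚ[X] - 1) ^ 2)) := by
  have h := derivT_momentFactor_succ 0
  simp only [Nat.antidiagonal_zero, sum_singleton, zero_add, Nat.choose_self, Nat.cast_one,
    one_smul, momentFactor_zero, twistedPowerSumOp_one_apply] at h
  rw [h, twistedDerivW_one, twistedDerivW_exp_sub_one, mul_smul_comm]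

theorem derivT_momentFactor_two :
    derivT (momentFactor 2) = (1 + w) * (w * twistedDerivW (twistedDerivW (momentFactor 1)) +
      (1 / 2 : ℚ) • (w * (exp ℚ[X] - 1) ^ 2) + (1 / 3 : ℚ) • (w ^ 2 * (exp ℚ[X] - 1) ^ 3)) := by
  have h := derivT_momentFactor_succ 1
  simp only [Nat.sum_antidiagonal_succ, Nat.antidiagonal_zero, sum_singleton, zero_add,
    one_add_one_eq_two, Nat.choose_self, Nat.choose_one_right, Nat.cast_one, Nat.cast_ofNat,
    one_smul, momentFactor_zero, twistedPowerSumOp_one_apply, twistedPowerSumOp_two_apply] at h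
  rw [h, twistedDerivW_one, twistedDerivW_exp_sub_one, twistedDerivW_exp_sub_one_pow]
  algebra

theorem four_smul_momentFactor_one :
    (4 : ℚ) • momentFactor 1 =
      (4 : ℚ) • (X * exp ℚ[X] * (1 + w)) + (2 : ℚ) • (X * exp ℚ[X] ^ 2 * (1 + w) ^ 2) +
      (2 : ℚ) • (1 + w) - (1 + w) ^ 2 + (4 : ℚ) • (exp ℚ[X] * (1 + w) ^ 2) -
      (2 : ℚ) • (exp ℚ[X] ^ 2 * (1 + w)) - (3 : ℚ) • (exp ℚ[X] ^ 2 * (1 + w) ^ 2) := by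
  refine eq_of_derivT_eq ?_ ?_
  · rw [Derivation.map_smul, derivT_momentFactor_one]
    simp only [Derivation.map_one_eq_zero, Derivation.leibniz, map_sub, map_add,
      Derivation.map_smul, Derivation.leibniz_pow, derivT_X, derivT_w, derivT_exp, smul_eq_mul,
      nsmul_eq_mul]
    norm_num only
    algebra
  · simp only [map_sub, map_add, map_mul, map_rat_smul, map_one, map_pow, constantCoeff_exp,
      constantCoeff_momentFactor_succ, w, constantCoeff_C, constantCoeff_X]
    algebra

theorem eighteen_smul_momentFactor_two :
    (18 : ℚ) • momentFactor 2 =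
      (18 : ℚ) • momentFactor 1 ^ 2 + (18 : ℚ) • (X ^ 2 * exp ℚ[X] * (1 + w)) +
      (45 : ℚ) • (X ^ 2 * exp ℚ[X] ^ 2 * (1 + w) ^ 2) +
      (18 : ℚ) • (X ^ 2 * exp ℚ[X] ^ 3 * (1 + w) ^ 3) - (18 : ℚ) • (X * exp ℚ[X] * (1 + w)) +
      (36 : ℚ) • (X * exp ℚ[X] * (1 + w) ^ 2) - (54 : ℚ) • (X * exp ℚ[X] ^ 2 * (1 + w)) -
      (90 : ℚ) • (X * exp ℚ[X] ^ 2 * (1 + w) ^ 2) + (36 : ℚ) • (X * exp ℚ[X] ^ 2 * (1 + w) ^ 3) -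
      (36 : ℚ) • (X * exp ℚ[X] ^ 3 * (1 + w) ^ 2) - (48 : ℚ) • (X * exp ℚ[X] ^ 3 * (1 + w) ^ 3) -
      (12 : ℚ) • (1 + w) + (12 : ℚ) • (1 + w) ^ 2 - (4 : ℚ) • (1 + w) ^ 3 -
      (36 : ℚ) • (exp ℚ[X] * (1 + w)) - (54 : ℚ) • (exp ℚ[X] * (1 + w) ^ 2) +
      (36 : ℚ) • (exp ℚ[X] * (1 + w) ^ 3) + (36 : ℚ) • (exp ℚ[X] ^ 2 * (1 + w)) -
      (18 : ℚ) • (exp ℚ[X] ^ 2 * (1 + w) ^ 2) - (72 : ℚ) • (exp ℚ[X] ^ 2 * (1 + w) ^ 3) +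
      (12 : ℚ) • (exp ℚ[X] ^ 3 * (1 + w)) + (60 : ℚ) • (exp ℚ[X] ^ 3 * (1 + w) ^ 2) +
      (40 : ℚ) • (exp ℚ[X] ^ 3 * (1 + w) ^ 3) := by
  refine eq_of_derivT_eq ?_ ?_
  · have hone := congrArg ((1 / 4 : ℚ) • ·) four_smul_momentFactor_one
    simp only [smul_smul] at hone
    norm_num only [one_smul] at hone
    simp only [map_add, map_sub, map_zero, Derivation.map_smul, Derivation.map_one_eq_zero,
      Derivation.map_natCast, Derivation.leibniz, Derivation.leibniz_pow, derivT_momentFactor_two,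
      hone, twistedDerivW_apply, derivW_X, derivW_w, derivW_exp, derivT_X, derivT_w, derivT_exp,
      smul_eq_mul, nsmul_eq_mul]
    norm_num only
    algebra
  · simp only [map_sub, map_add, map_mul, map_rat_smul, map_one, map_pow, constantCoeff_exp,
      constantCoeff_momentFactor_succ, w, constantCoeff_C, constantCoeff_X]
    algebra

end ExplicitFactors

section ExplicitMoments

/-- The exponential generating function of the sequence `n ↦ B (n + i)`. -/
noncomputable def shiftedBellSeries (i : ℕ) : ℚ⟦X⟧ := (d⁄dX ℚ)^[i] bellSeries

theorem shiftedBellSeries_zero : shiftedBellSeries 0 = bellSeries := rfl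

theorem derivative_shiftedBellSeries (i : ℕ) :
    d⁄dX ℚ (shiftedBellSeries i) = shiftedBellSeries (i + 1) :=
  (Function.iterate_succ_apply' _ i _).symm

theorem shiftedBellSeries_one : shiftedBellSeries 1 = exp ℚ * bellSeries :=
  derivative_bellSeries

theorem shiftedBellSeries_two : shiftedBellSeries 2 = (exp ℚ + exp ℚ ^ 2) * bellSeries := by
  simp only [← derivative_shiftedBellSeries, shiftedBellSeries_zero, Derivation.leibniz,
    derivative_bellSeries, derivative_exp, smul_eq_mul]
  ring

theorem shiftedBellSeries_three :
    shiftedBellSeries 3 = (exp ℚ + 3 * exp ℚ ^ 2 + exp ℚ ^ 3) * bellSeries := by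
  simp only [← derivative_shiftedBellSeries 2, shiftedBellSeries_two, map_add, Derivation.leibniz,
    Derivation.leibniz_pow, derivative_bellSeries, derivative_exp, smul_eq_mul, nsmul_eq_mul]
  norm_num only
  ring

theorem shiftedBellSeries_four :
    shiftedBellSeries 4 =
      (exp ℚ + 7 * exp ℚ ^ 2 + 6 * exp ℚ ^ 3 + exp ℚ ^ 4) * bellSeries := by
  have h : d⁄dX ℚ (3 : ℚ⟦X⟧) = 0 := Derivation.map_natCast _ 3
  simp only [← derivative_shiftedBellSeries 3, shiftedBellSeries_three, map_add, Derivation.leibniz,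
    Derivation.leibniz_pow, derivative_bellSeries, derivative_exp, smul_eq_mul, nsmul_eq_mul, h]
  norm_num only
  ring

theorem egfCoeff_shiftedBellSeries (n i : ℕ) :
    egfCoeff n (shiftedBellSeries i) = Nat.bell (n + i) := by
  induction i generalizing n with
  | zero => exact egfCoeff_bellSeries n
  | succ i ih =>
    rw [← derivative_shiftedBellSeries, egfCoeff_derivative, ih, add_assoc, add_comm 1]

theorem egfCoeff_X_pow_mul_shiftedBellSeries (n b i : ℕ) :
    egfCoeff n (X ^ b * shiftedBellSeries (i + b)) =
      (n.descFactorial b : ℚ) * Nat.bell (n + i) := by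
  rw [egfCoeff_X_pow_mul, egfCoeff_shiftedBellSeries, smul_eq_mul]
  rcases le_or_gt b n with hbn | hbn
  · rw [add_comm i, ← add_assoc, Nat.sub_add_cancel hbn]
  · rw [Nat.descFactorial_of_lt hbn, Nat.cast_zero, zero_mul, zero_mul]

theorem egfCoeff_X_mul_shiftedBellSeries (n i : ℕ) :
    egfCoeff n (X * shiftedBellSeries (i + 1)) = (n : ℚ) * Nat.bell (n + i) := by
  simpa only [pow_one, Nat.descFactorial_one] using egfCoeff_X_pow_mul_shiftedBellSeries n 1 i

theorem egfCoeff_X_sq_mul_shiftedBellSeries (n i : ℕ) :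
    egfCoeff n (X ^ 2 * shiftedBellSeries (i + 2)) = (n : ℚ) * (n - 1) * Nat.bell (n + i) := by
  rw [egfCoeff_X_pow_mul_shiftedBellSeries, Nat.cast_descFactorial_two]

theorem four_smul_closeBlocks_momentFactor_one :
    (4 : ℚ) • closeBlocks (momentFactor 1) =
      (4 : ℚ) • (X * exp ℚ) + (2 : ℚ) • (X * exp ℚ ^ 2) + 1 + (4 : ℚ) • exp ℚ -
        (5 : ℚ) • exp ℚ ^ 2 := by
  have h := congrArg closeBlocks four_smul_momentFactor_one
  simp only [map_add, map_sub, map_mul, map_pow, map_one, map_rat_smul, closeBlocks_X,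
    closeBlocks_exp, closeBlocks_w] at h
  rw [h]
  algebra

theorem four_smul_closeBlocks_momentFactor_one_mul_bellSeries :
    (4 : ℚ) • (closeBlocks (momentFactor 1) * bellSeries) =
      (2 : ℚ) • (X * shiftedBellSeries 1) + (2 : ℚ) • (X * shiftedBellSeries 2) +
      shiftedBellSeries 0 + (9 : ℚ) • shiftedBellSeries 1 - (5 : ℚ) • shiftedBellSeries 2 := by
  rw [← smul_mul_assoc, four_smul_closeBlocks_momentFactor_one, shiftedBellSeries_zero,
    shiftedBellSeries_one, shiftedBellSeries_two]
  algebra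

theorem smul_closeBlocks_momentFactor_two_mul_bellSeries :
    (144 : ℚ) • (closeBlocks (momentFactor 2) * bellSeries) =
      (36 : ℚ) • (X ^ 2 * shiftedBellSeries 2) + (72 : ℚ) • (X ^ 2 * shiftedBellSeries 3) +
      (36 : ℚ) • (X ^ 2 * shiftedBellSeries 4) + (60 : ℚ) • (X * shiftedBellSeries 1) +
      (144 : ℚ) • (X * shiftedBellSeries 2) + (192 : ℚ) • (X * shiftedBellSeries 3) -
      (180 : ℚ) • (X * shiftedBellSeries 4) - (23 : ℚ) • shiftedBellSeries 0 -
      (260 : ℚ) • shiftedBellSeries 1 + (489 : ℚ) • shiftedBellSeries 2 -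
      (814 : ℚ) • shiftedBellSeries 3 + (225 : ℚ) • shiftedBellSeries 4 := by
  have hone : closeBlocks (momentFactor 1) = (1 / 4 : ℚ) • ((4 : ℚ) • (X * exp ℚ) +
      (2 : ℚ) • (X * exp ℚ ^ 2) + 1 + (4 : ℚ) • exp ℚ - (5 : ℚ) • exp ℚ ^ 2) := by
    rw [← four_smul_closeBlocks_momentFactor_one]
    algebra
  have htwo := congrArg closeBlocks eighteen_smul_momentFactor_two
  simp only [map_add, map_sub, map_mul, map_pow, map_one, map_rat_smul, closeBlocks_X,
    closeBlocks_exp, closeBlocks_w] at htwo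
  have hscale : (144 : ℚ) • (closeBlocks (momentFactor 2) * bellSeries) =
      (8 : ℚ) • ((18 : ℚ) • closeBlocks (momentFactor 2) * bellSeries) := by algebra
  rw [hscale, htwo, hone, shiftedBellSeries_zero, shiftedBellSeries_one, shiftedBellSeries_two,
    shiftedBellSeries_three, shiftedBellSeries_four]
  algebra

theorem moment_one (n : ℕ) :
    moment 1 n = (1 / 4 : ℚ) * ((2 * (n : ℚ) + 1) * bell (n : ℤ) +
      (2 * (n : ℚ) + 9) * bell ((n : ℤ) + 1) - 5 * bell ((n : ℤ) + 2)) := by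
  have h := congrArg (egfCoeff n) four_smul_closeBlocks_momentFactor_one_mul_bellSeries
  simp only [map_add, map_sub, map_smul, smul_eq_mul, ← moment_eq_egfCoeff,
    egfCoeff_X_mul_shiftedBellSeries, egfCoeff_shiftedBellSeries, ← bell_natCast] at h
  push_cast [add_zero] at h
  linear_combination (1 / 4 : ℚ) * h

theorem moment_two (n : ℕ) :
    moment 2 n = (1 / 144 : ℚ) *
      ((36 * (n : ℚ) ^ 2 + 24 * (n : ℚ) - 23) * bell (n : ℤ) +
        (72 * (n : ℚ) ^ 2 + 72 * (n : ℚ) - 260) * bell ((n : ℤ) + 1) +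
        (36 * (n : ℚ) ^ 2 + 156 * (n : ℚ) + 489) * bell ((n : ℤ) + 2) -
        (180 * (n : ℚ) + 814) * bell ((n : ℤ) + 3) + 225 * bell ((n : ℤ) + 4)) := by
  have h := congrArg (egfCoeff n) smul_closeBlocks_momentFactor_two_mul_bellSeries
  simp only [map_add, map_sub, map_smul, smul_eq_mul, ← moment_eq_egfCoeff,
    egfCoeff_X_mul_shiftedBellSeries, egfCoeff_X_sq_mul_shiftedBellSeries,
    egfCoeff_shiftedBellSeries, ← bell_natCast] at h
  push_cast [add_zero] at h
  linear_combination (1 / 144 : ℚ) * h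

end ExplicitMoments

end SetPartition

theorem theorem3p4 :
    (∀ k : ℕ, ∃ Q : ℤ → Polynomial ℚ,
      (∀ j : ℕ, j ≤ 3 * k → (Q (2 * (k : ℤ) - (j : ℤ))).natDegree ≤ j) ∧
      ∀ n : ℕ, SetPartition.moment k n =
        ∑ m ∈ Finset.Icc (-(k : ℤ)) (2 * (k : ℤ)),
          (Q m).eval (n : ℚ) * SetPartition.bell ((n : ℤ) + m)) ∧
    (∀ n : ℕ, SetPartition.moment 1 n =
      (1 / 4 : ℚ) *
        ((2 * (n : ℚ) + 1) * SetPartition.bell (n : ℤ)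
          + (2 * (n : ℚ) + 9) * SetPartition.bell ((n : ℤ) + 1)
          - 5 * SetPartition.bell ((n : ℤ) + 2))) ∧
    (∀ n : ℕ, SetPartition.moment 2 n =
      (1 / 144 : ℚ) *
        ((36 * (n : ℚ) ^ 2 + 24 * (n : ℚ) - 23) * SetPartition.bell (n : ℤ)
          + (72 * (n : ℚ) ^ 2 + 72 * (n : ℚ) - 260) * SetPartition.bell ((n : ℤ) + 1)
          + (36 * (n : ℚ) ^ 2 + 156 * (n : ℚ) + 489) * SetPartition.bell ((n : ℤ) + 2)
          - (180 * (n : ℚ) + 814) * SetPartition.bell ((n : ℤ) + 3)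
          + 225 * SetPartition.bell ((n : ℤ) + 4))) :=
  ⟨SetPartition.moment_mem_bellCombinations, SetPartition.moment_one, SetPartition.moment_two⟩
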